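/- Let $n_0\ge 2$ and let $x_1,\dots,x_{n_0}$ be distinct real numbers. On a probability space let $(\chi_n)_{n\ge n_0}$ and $(\psi_n)_{n\ge n_0}$ be random variables, all mutually independent, such that $\chi_n$ is uniformly distributed on $\{1,\dots,n\}$ and $\psi_n$ is uniformly distributed on $(-1,1)$. Define a random sequence of points in $\mathbb R$ with initial points $x_1,\dots,x_{n_0}$ recursively by $$x_{n+1}=x_{\chi_n}+d_n(x_{\chi_n})\,\psi_n,\qquad n\ge n_0,$$ where $X_n=\{x_1,\dots,x_n\}$ and $d_n(x)=\min\{|x-x'|:\ x'\in X_n\setminus\{x\}\}$ is the distance from $x\in X_n$ to the closest other point of $X_n$. For $n\ge n_0$ let $\mu_n$ be the (random) distribution of the next added point $x_{n+1}$ given the points $x_1,\dots,x_n$, that is, $$\mu_n=\frac1n\sum_{k=1}^n \mathrm{Law}\bigl(x_k+d_n(x_k)\,\psi\bigr),\qquad \psi\sim\mathrm{Unif}(-1,1),$$ where in each summand $x_k$ and $d_n(x_k)$ are held fixed. Then there is a random probability measure $\mu^*$ on $\mathbb R$ such that, almost surely, $\mu_n$ converges weakly to $\mu^*$ as $n\to\infty$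 and the distribution function of $\mu^*$ is continuous. -/

import Mathlib

open MeasureTheory ProbabilityTheory Filter Topology

noncomputable section

namespace Lisa

/-- The distance from the `k`-th particle of the configuration `X` to the closest other
particle, that is, to the finite set `X \ {x_k}`. -/
def nearestDist {n : ℕ} (X : Fin n → ℝ) (k : Fin n) : ℝ :=
  Metric.infDist (X k) (Set.range X \ {X k})

/-- The configuration `X` of `n` particles with the new particle `x_k + d(x_k, X) t` appended:
`k` is the index of the parent and `t` the displacement in units of `d(x_k, X)`. -/
def addParticle {n : ℕ} (X : Fin n → ℝ) (k : Fin n) (t : ℝ) : Fin (n + 1) → ℝ :=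
  Fin.snoc X (X k + nearestDist X k * t)

/-- The configuration of `n₀ + m` particles obtained from the initial configuration `x₀` of `n₀`
particles after `m` steps. In step `m` (from `n₀ + m` to `n₀ + m + 1` particles) the parent has
index `χ m` and the scaled displacement is `ψ m`. -/
def config {n₀ : ℕ} (x₀ : Fin n₀ → ℝ) (χ : ∀ m : ℕ, Fin (n₀ + m)) (ψ : ℕ → ℝ) :
    ∀ m : ℕ, Fin (n₀ + m) → ℝ
  | 0 => x₀
  | m + 1 => addParticle (config x₀ χ ψ m) (χ m) (ψ m)

/-- The uniform distribution on the interval `(-1, 1)`. -/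
def unifLaw : Measure ℝ := cond volume (Set.Ioo (-1) 1)

instance : IsProbabilityMeasure unifLaw :=
  cond_isProbabilityMeasure_of_finite (by simp) (by simp)

/-- The distribution of the next particle, given the present configuration `X` of `n`
particles: the average over the `n` possible parents `x_k` of the law of `x_k + d(x_k, X) ψ`,
where `ψ` is uniform on `(-1, 1)`. -/
def nextMeasure {n : ℕ} (X : Fin n → ℝ) : Measure ℝ :=
  (n : ENNReal)⁻¹ • ∑ k : Fin n, unifLaw.map (fun t => X k + nearestDist X k * t)

theorem isProbabilityMeasure_nextMeasure {n : ℕ} (hn : 2 ≤ n) (X : Fin n → ℝ) :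
    IsProbabilityMeasure (nextMeasure X) := by
  have h : ∀ k : Fin n,
      unifLaw.map (fun t => X k + nearestDist X k * t) Set.univ = 1 := fun k => by
    rw [Measure.map_apply (by fun_prop) MeasurableSet.univ]
    simp
  refine ⟨?_⟩
  simp only [nextMeasure, Measure.smul_apply, Measure.coe_finsetSum, Finset.sum_apply, h,
    Finset.sum_const, Finset.card_univ, Fintype.card_fin, nsmul_eq_mul, mul_one, smul_eq_mul]
  exact ENNReal.inv_mul_cancel (by simp; omega) (by simp)

/-- `nextMeasure` as a point of the space of probability measures with the topology of weak
convergence. -/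
def nextLaw {n : ℕ} (hn : 2 ≤ n) (X : Fin n → ℝ) : ProbabilityMeasure ℝ :=
  ⟨nextMeasure X, isProbabilityMeasure_nextMeasure hn X⟩

end Lisa

end

namespace Lisa

/-! Fix the gaps cut out of the line by the first `N` particles. The reach of a particle on either
side contains no other particle, so each half of it lies in one gap. A later particle may shorten
these halves but cannot move them to another gap, while the reach of the new particle lies in the
gap where it landed. Hence `n * μ_n(gap)` grows by exactly the indicator that the new particle falls
into the gap (`hitMass_addParticle`), an event of conditional probability `μ_n(gap)`: a Pólya urn.

Two consequences follow. The mass `μ_n(gap)` is a bounded martingale and converges almost surely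
(`IsDriving.ae_tendsto_gapProb`). With `V = n * μ_n(gap)`, the expectation of `V (V + 1)` divided by
`n (n + 1)` is constant in `n`. At time `n = N` every `V` is at most `2` and their sum is at most
`N`, so the expected sum of squared gap masses stays of order `1 / N`, and for large `N` no gap
keeps much mass (`IsDriving.ae_frequently_gapProb_le`).

Convergent gap masses on a partition whose cells have small mass make the distribution functions
uniformly Cauchy (`exists_tendsto_of_levels`). Each of them is continuous, hence so is the limit. -/

/-! ### Weak convergence through distribution functions -/

theorem tendsto_of_tendsto_cdf {μ : ℕ → ProbabilityMeasure ℝ} {ν : ProbabilityMeasure ℝ}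
    (h : ∀ t, Tendsto (fun m => cdf (μ m : Measure ℝ) t) atTop (𝓝 (cdf (ν : Measure ℝ) t))) :
    Tendsto μ atTop (𝓝 ν) := by
  have key (ρ : ProbabilityMeasure ℝ) {a b : ℝ} (hab : a ≤ b) :
      ((ρ (Set.Ioc a b) : NNReal) : ℝ) = cdf (ρ : Measure ℝ) b - cdf (ρ : Measure ℝ) a := by
    rw [cdf_eq_real, cdf_eq_real, ← Set.Iic_sdiff_Iic,
      ← measureReal_sdiff (Set.Iic_subset_Iic.2 hab) measurableSet_Iic]
    rfl
  refine IsPiSystem.tendsto_probabilityMeasure_of_tendsto_of_mem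
    (S := {s | ∃ a b : ℝ, a < b ∧ Set.Ioc a b = s}) (isPiSystem_Ioc id id) ?_ ?_ ?_
  · rintro _ ⟨a, b, -, rfl⟩
    exact measurableSet_Ioc
  · intro u hu x hx
    obtain ⟨ε, hε, hb⟩ := Metric.isOpen_iff.1 hu x hx
    refine ⟨Set.Ioc (x - ε / 2) (x + ε / 2), ⟨_, _, by linarith, rfl⟩,
      Ioc_mem_nhds (by linarith) (by linarith), fun y hy => hb ?_⟩
    rw [Metric.mem_ball, Real.dist_eq, abs_lt]
    constructor <;> linarith [hy.1, hy.2]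
  · rintro _ ⟨a, b, hab, rfl⟩
    rw [← NNReal.tendsto_coe]
    simp only [key _ hab.le]
    exact (h b).sub (h a)

theorem continuous_cdf_of_measure_singleton (μ : Measure ℝ) [IsProbabilityMeasure μ]
    (hμ : ∀ x, μ {x} = 0) :
    Continuous (cdf μ) := by
  refine continuous_iff_continuousAt.2 fun x => ?_
  rw [(monotone_cdf μ).continuousAt_iff_leftLim_eq_rightLim, (cdf μ).rightLim_eq]
  have h : (cdf μ).measure {x} = 0 := by rw [measure_cdf]; exact hμ x
  rw [StieltjesFunction.measure_singleton, ENNReal.ofReal_eq_zero] at h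
  exact le_antisymm ((monotone_cdf μ).leftLim_le le_rfl) (by linarith)

/-- Probability measures whose distribution functions are continuous and uniformly Cauchy converge
weakly, to a measure with a continuous distribution function. -/
theorem exists_tendsto_of_uniformCauchy_cdf {μ : ℕ → ProbabilityMeasure ℝ}
    (hc : ∀ m, Continuous (cdf (μ m : Measure ℝ)))
    (h : ∀ ε > 0, ∃ N, ∀ m ≥ N, ∀ n ≥ N, ∀ t,
      |cdf (μ m : Measure ℝ) t - cdf (μ n : Measure ℝ) t| < ε) :
    ∃ ν : ProbabilityMeasure ℝ, Tendsto μ atTop (𝓝 ν) ∧ Continuous (cdf (ν : Measure ℝ)) := by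
  have hpt (t : ℝ) : ∃ l, Tendsto (fun m => cdf (μ m : Measure ℝ) t) atTop (𝓝 l) := by
    refine cauchySeq_tendsto_of_complete (Metric.cauchySeq_iff.2 fun ε hε => ?_)
    obtain ⟨N, hN⟩ := h ε hε
    exact ⟨N, fun m hm n hn => hN m hm n hn t⟩
  choose F hF using hpt
  have hunif : ∀ ε > 0, ∃ N, ∀ m ≥ N, ∀ t, |cdf (μ m : Measure ℝ) t - F t| ≤ ε := by
    intro ε hε
    obtain ⟨N, hN⟩ := h ε hε
    refine ⟨N, fun m hm t => ?_⟩
    refine le_of_tendsto (((hF t).const_sub _).abs) ?_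
    filter_upwards [eventually_ge_atTop N] with n hn
    exact (hN m hm n hn t).le
  have hFc : Continuous F := by
    have : TendstoUniformly (fun m t => cdf (μ m : Measure ℝ) t) F atTop := by
      rw [Metric.tendstoUniformly_iff]
      intro ε hε
      obtain ⟨N, hN⟩ := hunif (ε / 2) (by positivity)
      filter_upwards [eventually_ge_atTop N] with m hm t
      rw [dist_comm, Real.dist_eq]
      linarith [hN m hm t]
    exact this.continuous (Frequently.of_forall hc)
  have hFm : Monotone F := fun s t hst =>
    le_of_tendsto_of_tendsto' (hF s) (hF t) fun m => monotone_cdf _ hst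
  -- Uniform convergence carries the limits at both infinities over to `F`, so no mass escapes.
  have hlim {l : Filter ℝ} {c : ℝ}
      (hl : ∀ m, Tendsto (cdf (μ m : Measure ℝ)) l (𝓝 c)) : Tendsto F l (𝓝 c) := by
    refine Metric.tendsto_nhds.2 fun ε hε => ?_
    obtain ⟨N, hN⟩ := hunif (ε / 2) (by positivity)
    filter_upwards [Metric.tendsto_nhds.1 (hl N) (ε / 2) (by positivity)] with t ht
    have h1 := hN N le_rfl t
    rw [Real.dist_eq] at ht ⊢
    rw [abs_lt] at ht ⊢
    rw [abs_le] at h1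
    constructor <;> linarith
  let f : StieltjesFunction ℝ := ⟨F, hFm, fun x => hFc.continuousWithinAt⟩
  have hbot : Tendsto f atBot (𝓝 0) := hlim fun m => tendsto_cdf_atBot _
  have htop : Tendsto f atTop (𝓝 1) := hlim fun m => tendsto_cdf_atTop _
  have hcdf : cdf f.measure = f := cdf_measure_stieltjesFunction f hbot htop
  refine ⟨⟨f.measure, f.isProbabilityMeasure hbot htop⟩, tendsto_of_tendsto_cdf fun t => ?_, ?_⟩
  · simp only [ProbabilityMeasure.coe_mk, hcdf]
    exact hF t
  · simp only [ProbabilityMeasure.coe_mk, hcdf]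
    exact hFc

/-- For a monotone function `r` the set `Iic t` differs from the union of the level sets below
`r t` by at most the level set of `r t`. -/
theorem abs_cdf_sub_sum_level_le (μ : ProbabilityMeasure ℝ) {r : ℝ → ℕ} (hr : Monotone r) (t : ℝ) :
    0 ≤ cdf (μ : Measure ℝ) t - ∑ c ∈ Finset.range (r t), (μ : Measure ℝ).real (r ⁻¹' {c}) ∧
    cdf (μ : Measure ℝ) t - ∑ c ∈ Finset.range (r t), (μ : Measure ℝ).real (r ⁻¹' {c}) ≤
      (μ : Measure ℝ).real (r ⁻¹' {r t}) := by
  have hsum (n : ℕ) : (μ : Measure ℝ).real {y | r y < n} =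
      ∑ c ∈ Finset.range n, (μ : Measure ℝ).real (r ⁻¹' {c}) := by
    rw [← measureReal_biUnion_finset]
    · congr 1
      ext y
      simp
    · intro a _ b _ hab
      exact Disjoint.preimage r (by simpa using hab)
    · exact fun c _ => hr.measurable (measurableSet_singleton c)
  have h2 := hsum (r t + 1)
  rw [Finset.sum_range_succ] at h2
  rw [cdf_eq_real, ← hsum]
  have h3 : (μ : Measure ℝ).real {y | r y < r t} ≤ (μ : Measure ℝ).real (Set.Iic t) :=
    measureReal_mono fun y hy => le_of_not_gt fun hty => absurd (hr hty.le) (not_le.2 hy)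
  have h4 : (μ : Measure ℝ).real (Set.Iic t) ≤ (μ : Measure ℝ).real {y | r y < r t + 1} :=
    measureReal_mono fun y hy => Nat.lt_succ_of_le (hr hy)
  rw [hsum] at h3 h4 ⊢
  rw [Finset.sum_range_succ] at h4
  constructor <;> linarith

/-- Weak convergence with a continuous limit distribution function, if the masses of the level sets
of suitable monotone step functions converge and become uniformly small. -/
theorem exists_tendsto_of_levels {μ : ℕ → ProbabilityMeasure ℝ}
    (hc : ∀ m, Continuous (cdf (μ m : Measure ℝ)))
    (h : ∀ ε > 0, ∃ (r : ℝ → ℕ) (K : ℕ), Monotone r ∧ (∀ y, r y < K) ∧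
      (∀ c, ∃ p, Tendsto (fun m => (μ m : Measure ℝ).real (r ⁻¹' {c})) atTop (𝓝 p)) ∧
      ∃ᶠ m in atTop, ∀ c < K, (μ m : Measure ℝ).real (r ⁻¹' {c}) ≤ ε) :
    ∃ ν : ProbabilityMeasure ℝ, Tendsto μ atTop (𝓝 ν) ∧ Continuous (cdf (ν : Measure ℝ)) := by
  refine exists_tendsto_of_uniformCauchy_cdf hc fun ε hε => ?_
  obtain ⟨r, K, hr, hK, hp, hfr⟩ := h (ε / 8) (by positivity)
  choose p hp using hp
  -- Since the level masses converge, smallness along infinitely many `m` bounds the limits, hence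
  -- all late masses.
  have hpε (c : ℕ) (hc : c < K) : p c ≤ ε / 8 :=
    le_of_tendsto_of_frequently (hp c) (hfr.mono fun m hm => hm c hc)
  have hsum (n : ℕ) : Tendsto
      (fun m => ∑ c ∈ Finset.range n, (μ m : Measure ℝ).real (r ⁻¹' {c})) atTop
      (𝓝 (∑ c ∈ Finset.range n, p c)) := tendsto_finsetSum _ fun c _ => hp c
  have hev : ∀ᶠ m in atTop, ∀ n < K,
      |(∑ c ∈ Finset.range n, (μ m : Measure ℝ).real (r ⁻¹' {c})) - ∑ c ∈ Finset.range n, p c|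
        < ε / 8 ∧ (μ m : Measure ℝ).real (r ⁻¹' {n}) < ε / 4 := by
    refine (eventually_all_finite (Set.finite_lt_nat K)).2 fun n hn => ?_
    exact (Metric.tendsto_nhds.1 (hsum n) (ε / 8) (by positivity)).and
      ((hp n).eventually_lt_const (by linarith [hpε n hn]))
  obtain ⟨N, hN⟩ := eventually_atTop.1 hev
  refine ⟨N, fun m hm n hn t => ?_⟩
  have a1 := hN m hm _ (hK t)
  have a2 := hN n hn _ (hK t)
  have b1 := abs_cdf_sub_sum_level_le (μ m) hr t
  have b2 := abs_cdf_sub_sum_level_le (μ n) hr t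
  -- The partial sums differ by less than `ε / 8 + ε / 8`, and the level containing `t` contributes
  -- less than `ε / 4`.
  simp only [abs_lt] at a1 a2 ⊢
  constructor <;> linarith [a1.1.1, a1.1.2, a1.2, a2.1.1, a2.1.2, a2.2, b1.1, b1.2, b2.1, b2.2]

/-! ### Nearest distances and distinctness of particles -/

theorem unifLaw_absolutelyContinuous : unifLaw ≪ volume := cond_absolutelyContinuous

theorem ae_unifLaw : ∀ᵐ t ∂unifLaw, |t| < 1 ∧ t ≠ 0 := by
  have h1 : ∀ᵐ t ∂unifLaw, t ∈ Set.Ioo (-1 : ℝ) 1 := ae_cond_mem measurableSet_Ioo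
  have h2 : ∀ᵐ t ∂unifLaw, t ≠ 0 :=
    unifLaw_absolutelyContinuous.ae_le (Measure.ae_ne volume 0)
  filter_upwards [h1, h2] with t ht h0
  exact ⟨abs_lt.2 ht, h0⟩

theorem nearestDist_le {n : ℕ} (X : Fin n → ℝ) {j k : Fin n} (h : X j ≠ X k) :
    nearestDist X k ≤ |X k - X j| :=
  Metric.infDist_le_dist_of_mem ⟨⟨j, rfl⟩, h⟩

theorem nearestDist_nonneg {n : ℕ} (X : Fin n → ℝ) (k : Fin n) : 0 ≤ nearestDist X k :=
  Metric.infDist_nonneg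

/-- Two particles are needed because `Metric.infDist` to the empty set is `0`. -/
theorem nearestDist_pos {n : ℕ} (hn : 2 ≤ n) {X : Fin n → ℝ} (hX : X.Injective) (k : Fin n) :
    0 < nearestDist X k := by
  have : Nontrivial (Fin n) := Fin.nontrivial_iff_two_le.2 hn
  obtain ⟨j, hj⟩ := exists_ne k
  have hfin : (Set.range X \ {X k}).Finite := (Set.finite_range X).subset Set.sdiff_subset
  refine (hfin.isClosed.notMem_iff_infDist_pos ⟨X j, ⟨j, rfl⟩, fun h => hj (hX h)⟩).1 ?_
  simp

theorem nearestDist_addParticle_le {n : ℕ} (hn : 2 ≤ n) {X : Fin n → ℝ} (hX : X.Injective)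
    (k j : Fin n) (t : ℝ) :
    nearestDist (addParticle X k t) j.castSucc ≤ nearestDist X j := by
  have : Nontrivial (Fin n) := Fin.nontrivial_iff_two_le.2 hn
  obtain ⟨i, hi⟩ := exists_ne j
  have hj : addParticle X k t j.castSucc = X j := Fin.snoc_castSucc _ _ _
  unfold nearestDist
  rw [hj]
  refine Metric.infDist_le_infDist_of_subset (Set.sdiff_subset_sdiff_left ?_)
    ⟨X i, ⟨i, rfl⟩, fun h => hi (hX h)⟩
  rintro _ ⟨l, rfl⟩
  exact ⟨l.castSucc, Fin.snoc_castSucc _ _ _⟩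

/-- The new particle differs from its parent and is closer to it than any other particle is. -/
theorem addParticle_injective {n : ℕ} (hn : 2 ≤ n) {X : Fin n → ℝ} (hX : X.Injective)
    (k : Fin n) {t : ℝ} (ht : |t| < 1) (ht0 : t ≠ 0) : (addParticle X k t).Injective := by
  have hd := nearestDist_pos hn hX k
  refine Fin.snoc_injective_iff.2 ⟨hX, ?_⟩
  rintro ⟨j, hj⟩
  have habs : |X k - X j| = nearestDist X k * |t| := by
    rw [hj, sub_add_cancel_left, abs_neg, abs_mul, abs_of_pos hd]
  by_cases hjk : j = k
  · subst hjk
    simp [hd.ne', ht0] at habs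
  · have := nearestDist_le X (fun h => hjk (hX h))
    rw [habs] at this
    nlinarith

/-! ### The urn identity for one step -/

/-- The set `A` is a union of intervals whose endpoints are particles of `X`: two points not
separated by a particle are both in `A` or both outside of `A`. -/
def Compatible {n : ℕ} (X : Fin n → ℝ) (A : Set ℝ) : Prop :=
  ∀ u v : ℝ, u ≤ v → (∀ k, X k ∉ Set.Ico u v) → (u ∈ A ↔ v ∈ A)

theorem Compatible.of_uIcc {n : ℕ} {X : Fin n → ℝ} {A : Set ℝ} (hA : Compatible X A) {u v : ℝ}
    (h : ∀ k, X k ∉ Set.uIcc u v) : u ∈ A ↔ v ∈ A := by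
  rcases le_total u v with huv | huv
  · refine hA u v huv fun k hk => h k ?_
    rw [Set.uIcc_of_le huv]
    exact ⟨hk.1, hk.2.le⟩
  · refine (hA v u huv fun k hk => h k ?_).symm
    rw [Set.uIcc_of_ge huv]
    exact ⟨hk.1, hk.2.le⟩

/-- The probability that the next particle falls into `A`, multiplied by the number of particles. -/
noncomputable def hitMass {n : ℕ} (X : Fin n → ℝ) (A : Set ℝ) : ENNReal :=
  ∑ k : Fin n, unifLaw ((fun t => X k + nearestDist X k * t) ⁻¹' A)

theorem nextMeasure_apply {n : ℕ} (X : Fin n → ℝ) {A : Set ℝ} (hA : MeasurableSet A) :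
    nextMeasure X A = (n : ENNReal)⁻¹ * hitMass X A := by
  simp only [nextMeasure, hitMass, Measure.smul_apply, Measure.coe_finsetSum, Finset.sum_apply,
    smul_eq_mul]
  congr 1
  refine Finset.sum_congr rfl fun k _ => ?_
  rw [Measure.map_apply (by fun_prop) hA]

/-- The old parents contribute what they did before, as a shortened half-reach stays in its gap. The
new particle, used as a parent, contributes all or nothing, since its reach crosses no old particle.
-/
theorem hitMass_addParticle {n : ℕ} (hn : 2 ≤ n) {X : Fin n → ℝ} (hX : X.Injective) {A : Set ℝ}
    (hA : Compatible X A) (k : Fin n) {t : ℝ} (ht : |t| < 1) (ht0 : t ≠ 0) :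
    hitMass (addParticle X k t) A =
      hitMass X A + A.indicator 1 (X k + nearestDist X k * t) := by
  have hX' := addParticle_injective hn hX k ht ht0
  have hcast (j : Fin n) : addParticle X k t j.castSucc = X j := Fin.snoc_castSucc _ _ _
  have hlast : addParticle X k t (Fin.last n) = X k + nearestDist X k * t := Fin.snoc_last _ _
  unfold hitMass
  rw [Fin.sum_univ_castSucc]
  congr 1
  · refine Finset.sum_congr rfl fun j _ => measure_congr ?_
    have h1 := nearestDist_pos (by omega) hX' j.castSucc
    have h2 := nearestDist_addParticle_le hn hX k j t
    rw [hcast]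
    set r := nearestDist (addParticle X k t) j.castSucc
    refine eventuallyEq_set.2 ?_
    filter_upwards [ae_unifLaw] with s ⟨hs, hs0⟩
    refine hA.of_uIcc fun i hi => ?_
    -- A particle between the displaced points at scales `r` and `nearestDist X j` would be at
    -- distance `θ * |s|` from `X j`, less than the nearest distance.
    obtain ⟨θ, hθ, hθi⟩ : ∃ θ, 0 < θ ∧ θ ≤ nearestDist X j ∧ X i = X j + θ * s := by
      have hmem : (X i - X j) / s ∈ Set.Icc r (nearestDist X j) := by
        rcases lt_or_gt_of_ne hs0 with hneg | hpos
        · rw [Set.uIcc_of_ge (by nlinarith)] at hi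
          constructor
          · rw [le_div_iff_of_neg hneg]; linarith [hi.2]
          · rw [div_le_iff_of_neg hneg]; linarith [hi.1]
        · rw [Set.uIcc_of_le (by nlinarith)] at hi
          constructor
          · rw [le_div_iff₀ hpos]; linarith [hi.1]
          · rw [div_le_iff₀ hpos]; linarith [hi.2]
      refine ⟨(X i - X j) / s, h1.trans_le hmem.1, hmem.2, ?_⟩
      field_simp
      ring
    have hne : X i ≠ X j := by
      rw [hθi.2]
      simp [hθ.ne', hs0]
    have h3 := nearestDist_le X hne
    rw [hθi.2, sub_add_cancel_left, abs_neg, abs_mul, abs_of_pos hθ] at h3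
    nlinarith
  · have hmem : ∀ᵐ s ∂unifLaw, (addParticle X k t (Fin.last n) +
        nearestDist (addParticle X k t) (Fin.last n) * s ∈ A ↔
          X k + nearestDist X k * t ∈ A) := by
      filter_upwards [ae_unifLaw] with s ⟨hs, hs0⟩
      have hpos := nearestDist_pos (by omega) hX' (Fin.last n)
      rw [← hlast]
      refine hA.of_uIcc fun i hi => ?_
      have h3 := nearestDist_le (addParticle X k t) (j := i.castSucc) (k := Fin.last n)
        fun h => (Fin.castSucc_lt_last i).ne (hX' h)
      rw [hcast] at h3
      have h4 := Set.abs_sub_right_of_mem_uIcc hi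
      rw [sub_add_cancel_left, abs_neg, abs_mul, abs_of_pos hpos] at h4
      nlinarith
    by_cases hz : X k + nearestDist X k * t ∈ A
    · rw [Set.indicator_of_mem hz, Pi.one_apply]
      refine (measure_congr (eventuallyEq_set.2 ?_)).trans (measure_univ (μ := unifLaw))
      filter_upwards [hmem] with s hs
      simpa [hz] using hs
    · rw [Set.indicator_of_notMem hz]
      refine (measure_congr (eventuallyEq_set.2 ?_)).trans (measure_empty (μ := unifLaw))
      filter_upwards [hmem] with s hs
      simpa [hz] using hs

/-! ### Gaps between the first particles -/

/-- The number of particles below `y` among those with index less than `N`. -/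
noncomputable def rankBelow {n : ℕ} (N : ℕ) (X : Fin n → ℝ) (y : ℝ) : ℕ :=
  (Finset.univ.filter fun k : Fin n => (k : ℕ) < N ∧ X k < y).card

/-- The level sets of `rankBelow N X`: the gaps between the first `N` particles. -/
def cell {n : ℕ} (N : ℕ) (X : Fin n → ℝ) (c : ℕ) : Set ℝ := rankBelow N X ⁻¹' {c}

theorem rankBelow_mono {n : ℕ} (N : ℕ) (X : Fin n → ℝ) : Monotone (rankBelow N X) :=
  fun _ _ h => Finset.card_le_card <|
    Finset.monotone_filter_right _ fun _ _ hk => ⟨hk.1, hk.2.trans_le h⟩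

theorem rankBelow_lt {n : ℕ} (N : ℕ) (X : Fin n → ℝ) (y : ℝ) : rankBelow N X y < n + 1 :=
  Nat.lt_succ_of_le ((Finset.card_le_univ _).trans_eq (Fintype.card_fin n))

theorem measurableSet_cell {n : ℕ} (N : ℕ) (X : Fin n → ℝ) (c : ℕ) : MeasurableSet (cell N X c) :=
  (rankBelow_mono N X).measurable (measurableSet_singleton c)

/-- The strict inequality in `rankBelow` makes cells closed on the right, which matches `Set.Ico` in
`Compatible`. -/
theorem compatible_cell {n : ℕ} (N : ℕ) (X : Fin n → ℝ) (c : ℕ) : Compatible X (cell N X c) := by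
  intro u v huv h
  have : rankBelow N X u = rankBelow N X v := by
    unfold rankBelow
    congr 1
    refine Finset.filter_congr fun k _ => and_congr_right fun _ => ?_
    exact ⟨fun hk => hk.trans_le huv, fun hk => lt_of_not_ge fun hu => h k ⟨hu, hk⟩⟩
  simp [cell, this]

theorem rankBelow_addParticle {n N : ℕ} (hN : N ≤ n) (X : Fin n → ℝ) (k : Fin n) (t : ℝ) :
    rankBelow N (addParticle X k t) = rankBelow N X := by
  ext y
  have hcast (j : Fin n) : addParticle X k t j.castSucc = X j := Fin.snoc_castSucc _ _ _
  simp only [rankBelow, Finset.card_filter]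
  rw [Fin.sum_univ_castSucc]
  simp [hN, hcast]

theorem cell_addParticle {n N : ℕ} (hN : N ≤ n) (X : Fin n → ℝ) (k : Fin n) (t : ℝ) (c : ℕ) :
    cell N (addParticle X k t) c = cell N X c := by
  rw [cell, rankBelow_addParticle hN, cell]

theorem rankBelow_injective {n : ℕ} {X : Fin n → ℝ} (hX : X.Injective) :
    Function.Injective fun k => rankBelow n X (X k) := by
  have key {i j : Fin n} (h : X i < X j) : rankBelow n X (X i) < rankBelow n X (X j) := by
    refine Finset.card_lt_card (Finset.ssubset_iff_of_subset ?_ |>.2 ⟨i, by simp [h], by simp⟩)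
    exact Finset.monotone_filter_right _ fun _ _ hk => ⟨hk.1, hk.2.trans h⟩
  intro i j hij
  by_contra hne
  rcases lt_or_gt_of_ne (fun h => hne (hX h)) with h | h
  · exact (key h).ne hij
  · exact (key h).ne' hij

/-- A displacement shorter than the nearest distance passes no other particle, so only the parent
itself can change from uncounted to counted. -/
theorem rankBelow_near {n : ℕ} {X : Fin n → ℝ} (hX : X.Injective) (k : Fin n) {t : ℝ}
    (ht : |t| < 1) :
    rankBelow n X (X k + nearestDist X k * t) = rankBelow n X (X k) ∨
      rankBelow n X (X k + nearestDist X k * t) = rankBelow n X (X k) + 1 := by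
  have hd := nearestDist_nonneg X k
  obtain ⟨ht1, ht2⟩ := abs_lt.1 ht
  have hbd {j : Fin n} (hj : j ≠ k) : X j < X k ∧ X j ≤ X k - nearestDist X k ∨
      X k < X j ∧ X k + nearestDist X k ≤ X j := by
    have h := nearestDist_le X (fun h => hj (hX h))
    rcases lt_or_gt_of_ne (fun h => hj (hX h)) with h' | h'
    · rw [abs_of_pos (by linarith)] at h
      exact Or.inl ⟨h', by linarith⟩
    · rw [abs_of_neg (by linarith)] at h
      exact Or.inr ⟨h', by linarith⟩
  set y := X k + nearestDist X k * t with hy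
  have hsub : ∀ j ≠ k, X j < y ↔ X j < X k := by
    intro j hj
    rcases hbd hj with ⟨h1, h2⟩ | ⟨h1, h2⟩
    · have hp : 0 < nearestDist X k ∨ nearestDist X k = 0 := hd.lt_or_eq.imp_right Eq.symm
      rcases hp with hp | hp
      · exact ⟨fun _ => h1, fun _ => by nlinarith⟩
      · rw [hy, hp, zero_mul, add_zero]
    · exact ⟨fun h => by nlinarith, fun h => absurd h h1.not_gt⟩
  by_cases hk : X k < y
  · right
    have : (Finset.univ.filter fun j : Fin n => (j : ℕ) < n ∧ X j < y) =
        insert k (Finset.univ.filter fun j : Fin n => (j : ℕ) < n ∧ X j < X k) := by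
      ext j
      by_cases hj : j = k
      · simp [hj, hk]
      · simp [hj, hsub j hj]
    rw [rankBelow, this, Finset.card_insert_of_notMem (by simp), rankBelow]
  · left
    unfold rankBelow
    congr 1
    refine Finset.filter_congr fun j _ => and_congr_right fun _ => ?_
    by_cases hj : j = k
    · simp [hj, hk]
    · exact hsub j hj

/-- Only parents of rank `c` or `c - 1` reach the cell, and ranks are distinct, so at most two terms
are nonzero. -/
theorem hitMass_cell_le {n : ℕ} {X : Fin n → ℝ} (hX : X.Injective) (c : ℕ) :
    hitMass X (cell n X c) ≤ 2 := by
  classical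
  have hterm (k : Fin n) : unifLaw ((fun t => X k + nearestDist X k * t) ⁻¹' cell n X c) ≤
      (if rankBelow n X (X k) = c then 1 else 0) +
        (if rankBelow n X (X k) + 1 = c then 1 else 0) := by
    by_cases h : rankBelow n X (X k) = c ∨ rankBelow n X (X k) + 1 = c
    · refine (prob_le_one (μ := unifLaw)).trans ?_
      rcases h with h | h <;> simp [h]
    · push Not at h
      refine le_of_eq_of_le ((measure_eq_zero_iff_ae_notMem).2 ?_) zero_le
      filter_upwards [ae_unifLaw] with t ht hmem
      have hmem' : rankBelow n X (X k + nearestDist X k * t) = c := hmem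
      rcases rankBelow_near hX k ht.1 with h' | h'
      · exact h.1 (h'.symm.trans hmem')
      · exact h.2 (h'.symm.trans hmem')
  have hone (f : Fin n → ℕ) (hf : f.Injective) :
      (∑ k : Fin n, if f k = c then (1 : ENNReal) else 0) ≤ 1 := by
    rw [Finset.sum_boole]
    have : (Finset.univ.filter fun k => f k = c).card ≤ 1 := Finset.card_le_one.2 fun a ha b hb =>
      hf ((Finset.mem_filter.1 ha).2.trans (Finset.mem_filter.1 hb).2.symm)
    exact_mod_cast this
  refine (Finset.sum_le_sum fun k _ => hterm k).trans ?_
  rw [Finset.sum_add_distrib, ← one_add_one_eq_two]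
  exact add_le_add (hone _ (rankBelow_injective hX))
    (hone _ fun a b hab => rankBelow_injective hX (Nat.succ_injective hab))

theorem sum_hitMass_cell_le {n : ℕ} (N : ℕ) (X : Fin n → ℝ) (s : Finset ℕ) :
    ∑ c ∈ s, hitMass X (cell N X c) ≤ n := by
  unfold hitMass
  rw [Finset.sum_comm]
  calc _ ≤ ∑ _k : Fin n, (1 : ENNReal) := by
        refine Finset.sum_le_sum fun k _ => ?_
        refine (sum_measure_le_measure_univ (μ := unifLaw) (fun c _ => ?_) ?_).trans_eq measure_univ
        · exact ((by fun_prop : Measurable fun t => X k + nearestDist X k * t)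
            (measurableSet_cell N X c)).nullMeasurableSet
        · intro a _ b _ hab
          refine Disjoint.aedisjoint (Disjoint.preimage _ (Disjoint.preimage _ ?_))
          simpa using hab
    _ = n := by simp

theorem hitMass_le {n : ℕ} (X : Fin n → ℝ) (A : Set ℝ) : hitMass X A ≤ n :=
  (Finset.sum_le_sum fun _ _ => prob_le_one).trans_eq (by simp)

theorem nextMeasure_singleton {n : ℕ} (hn : 2 ≤ n) {X : Fin n → ℝ} (hX : X.Injective) (x : ℝ) :
    nextMeasure X {x} = 0 := by
  rw [nextMeasure_apply X (measurableSet_singleton x), hitMass, Finset.sum_eq_zero, mul_zero]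
  intro k _
  refine unifLaw_absolutelyContinuous ?_
  have hd := nearestDist_pos hn hX k
  have : ((fun t => X k + nearestDist X k * t) ⁻¹' {x}).Subsingleton := by
    intro a ha b hb
    have h : X k + nearestDist X k * a = X k + nearestDist X k * b :=
      Eq.trans ha (Eq.symm hb)
    exact mul_left_cancel₀ hd.ne' (add_left_cancel h)
  exact this.measure_zero volume

/-! ### Measurability in the configuration -/

theorem measurable_nearestDist {n : ℕ} (k : Fin n) :
    Measurable fun X : Fin n → ℝ => nearestDist X k := by
  refine measurable_of_Iio fun r => ?_
  -- The second set covers coinciding particles, where `infDist` to the empty set is `0`.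
  have h : (fun X : Fin n → ℝ => nearestDist X k) ⁻¹' Set.Iio r =
      (⋃ j, {X | X j ≠ X k ∧ dist (X k) (X j) < r}) ∪
        ((⋂ j, {X | X j = X k}) ∩ {_X | 0 < r}) := by
    ext X
    by_cases hne : (Set.range X \ {X k}).Nonempty
    · obtain ⟨_, ⟨j, rfl⟩, hj⟩ := id hne
      have h1 : ¬ ∀ i, X i = X k := fun h => hj (h j)
      simp only [Set.mem_preimage, Set.mem_Iio, nearestDist]
      rw [Metric.infDist_lt_iff hne]
      simp [h1]
    · have h0 : Set.range X \ {X k} = ∅ := Set.not_nonempty_iff_eq_empty.1 hne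
      have h1 : ∀ i, X i = X k := fun i => by
        by_contra hi
        exact hne ⟨X i, ⟨i, rfl⟩, hi⟩
      simp [nearestDist, h0, h1]
  rw [h]
  refine (MeasurableSet.iUnion fun j => ?_).union
    ((MeasurableSet.iInter fun j => ?_).inter (MeasurableSet.const _))
  · exact (measurableSet_eq_fun (measurable_pi_apply j) (measurable_pi_apply k)).compl.inter
      (measurableSet_lt ((measurable_pi_apply k).dist (measurable_pi_apply j)) measurable_const)
  · exact measurableSet_eq_fun (measurable_pi_apply j) (measurable_pi_apply k)

theorem measurable_newParticle {n : ℕ} :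
    Measurable fun p : (Fin n → ℝ) × Fin n × ℝ => p.1 p.2.1 + nearestDist p.1 p.2.1 * p.2.2 := by
  have h : (fun p : (Fin n → ℝ) × Fin n × ℝ => p.1 p.2.1 + nearestDist p.1 p.2.1 * p.2.2) =
      fun p => ∑ j, if p.2.1 = j then p.1 j + nearestDist p.1 j * p.2.2 else 0 := by
    ext p
    simp
  rw [h]
  refine Finset.measurable_sum _ fun j _ => Measurable.ite ?_ ?_ measurable_const
  · exact measurable_snd.fst (measurableSet_singleton j)
  · have := (measurable_nearestDist j).comp (measurable_fst : Measurable (Prod.fst : (Fin n → ℝ) × Fin n × ℝ → _))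
    exact (((measurable_pi_apply j).comp measurable_fst).add (this.mul measurable_snd.snd))

theorem measurable_addParticle {n : ℕ} :
    Measurable fun p : (Fin n → ℝ) × Fin n × ℝ => addParticle p.1 p.2.1 p.2.2 := by
  refine measurable_pi_iff.2 fun i => ?_
  refine Fin.lastCases ?_ (fun j => ?_) i
  · simpa only [addParticle, Fin.snoc_last] using measurable_newParticle
  · simp only [addParticle, Fin.snoc_castSucc]
    exact (measurable_pi_apply j).comp measurable_fst

theorem measurableSet_mem_cell {n : ℕ} (N c : ℕ) :
    MeasurableSet {p : (Fin n → ℝ) × ℝ | p.2 ∈ cell N p.1 c} := by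
  have h : Measurable fun p : (Fin n → ℝ) × ℝ => rankBelow N p.1 p.2 := by
    simp only [rankBelow, Finset.card_filter]
    refine Finset.measurable_sum _ fun k _ => Measurable.ite ?_ measurable_const measurable_const
    exact (MeasurableSet.const _).inter (measurableSet_lt (by fun_prop) measurable_snd)
  exact h (measurableSet_singleton c)

theorem measurable_hitMass {n : ℕ} {S : Set ((Fin n → ℝ) × ℝ)} (hS : MeasurableSet S) :
    Measurable fun X : Fin n → ℝ => hitMass X {z | (X, z) ∈ S} := by
  refine Finset.measurable_sum _ fun k _ => ?_
  have h : Measurable fun p : (Fin n → ℝ) × ℝ => (p.1, p.1 k + nearestDist p.1 k * p.2) :=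
    measurable_fst.prodMk
      (measurable_newParticle.comp (measurable_fst.prodMk (measurable_const.prodMk measurable_snd)))
  exact measurable_measure_prodMk_left (h hS)

theorem measurable_hitMass_cell {n : ℕ} (N c : ℕ) :
    Measurable fun X : Fin n → ℝ => hitMass X (cell N X c) :=
  measurable_hitMass (S := {p : (Fin n → ℝ) × ℝ | p.2 ∈ cell N p.1 c}) (measurableSet_mem_cell N c)

theorem measurable_nextMeasure_Iic {n : ℕ} (t : ℝ) :
    Measurable fun X : Fin n → ℝ => nextMeasure X (Set.Iic t) := by
  simp only [nextMeasure_apply _ measurableSet_Iic]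
  exact (measurable_hitMass (measurable_snd measurableSet_Iic)).const_mul _

theorem lintegral_nextMeasure {n : ℕ} (X : Fin n → ℝ) {f : ℝ → ENNReal} (hf : Measurable f) :
    ∫⁻ z, f z ∂nextMeasure X =
      (n : ENNReal)⁻¹ * ∑ k, ∫⁻ t, f (X k + nearestDist X k * t) ∂unifLaw := by
  rw [nextMeasure, lintegral_smul_measure, lintegral_finsetSum_measure, smul_eq_mul]
  congr 1
  exact Finset.sum_congr rfl fun k _ => lintegral_map hf (by fun_prop)

/-! ### The random process and its conditional laws -/

/-- The parent indices `χ` and the scaled displacements `ψ` are independent and uniformly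
distributed. -/
structure IsDriving {Ω : Type*} [MeasurableSpace Ω] (P : Measure Ω) (n₀ : ℕ)
    (χ : ∀ m : ℕ, Ω → Fin (n₀ + m)) (ψ : ℕ → Ω → ℝ) : Prop where
  measurable_parent : ∀ m, Measurable (χ m)
  measurable_disp : ∀ m, Measurable (ψ m)
  parent_eq : ∀ (m : ℕ) (k : Fin (n₀ + m)), P {ω | χ m ω = k} = ((n₀ + m : ℕ) : ENNReal)⁻¹
  map_disp : ∀ m, P.map (ψ m) = unifLaw
  iIndep : iIndepFun (fun m ω => (χ m ω, ψ m ω)) P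
  indep : ∀ m, IndepFun (χ m) (ψ m) P

/-- The random configuration after `m` steps. -/
noncomputable def proc {Ω : Type*} {n₀ : ℕ} (x₀ : Fin n₀ → ℝ) (χ : ∀ m : ℕ, Ω → Fin (n₀ + m))
    (ψ : ℕ → Ω → ℝ) (m : ℕ) (ω : Ω) : Fin (n₀ + m) → ℝ :=
  config x₀ (fun i => χ i ω) (fun i => ψ i ω) m

section Pathwise

variable {Ω : Type*} {n₀ : ℕ} {x₀ : Fin n₀ → ℝ}
  {χ : ∀ m : ℕ, Ω → Fin (n₀ + m)} {ψ : ℕ → Ω → ℝ}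

theorem proc_succ (x₀ : Fin n₀ → ℝ) (χ : ∀ m : ℕ, Ω → Fin (n₀ + m)) (ψ : ℕ → Ω → ℝ)
    (m : ℕ) (ω : Ω) :
    proc x₀ χ ψ (m + 1) ω = addParticle (proc x₀ χ ψ m ω) (χ m ω) (ψ m ω) := rfl

/-- Dependence on the inputs before step `m` alone is what makes the configuration independent of
the inputs of step `m`. -/
theorem measurable_proc_iSup (x₀ : Fin n₀ → ℝ) (χ : ∀ m : ℕ, Ω → Fin (n₀ + m)) (ψ : ℕ → Ω → ℝ)
    (m : ℕ) :
    Measurable[⨆ i ∈ Set.Iio m, MeasurableSpace.comap (fun ω => (χ i ω, ψ i ω)) inferInstance]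
      (proc x₀ χ ψ m) := by
  induction m with
  | zero => exact @measurable_const _ _ _ (_) x₀
  | succ m ih =>
    have h1 := ih.mono (biSup_mono fun i (hi : i < m) => hi.trans (Nat.lt_succ_self m)) le_rfl
    have h2 : Measurable[⨆ i ∈ Set.Iio (m + 1),
        MeasurableSpace.comap (fun ω => (χ i ω, ψ i ω)) inferInstance]
        (fun ω => (χ m ω, ψ m ω)) :=
      (comap_measurable _).mono
        (le_biSup (fun i => MeasurableSpace.comap (fun ω => (χ i ω, ψ i ω)) inferInstance)
          (Nat.lt_succ_self m)) le_rfl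
    exact measurable_addParticle.comp (h1.prodMk h2)

/-- The mass of the gap number `c` between the first `N` particles after `m` steps, multiplied by
the number of particles. -/
noncomputable def gapMass (x₀ : Fin n₀ → ℝ) (χ : ∀ m : ℕ, Ω → Fin (n₀ + m)) (ψ : ℕ → Ω → ℝ)
    (N c m : ℕ) (ω : Ω) : ENNReal :=
  hitMass (proc x₀ χ ψ m ω) (cell N (proc x₀ χ ψ m ω) c)

/-- The indicator of the event that the particle added in step `m` falls into the gap number `c`
between the first `N` particles. -/
noncomputable def gapHit (x₀ : Fin n₀ → ℝ) (χ : ∀ m : ℕ, Ω → Fin (n₀ + m)) (ψ : ℕ → Ω → ℝ)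
    (N c m : ℕ) (ω : Ω) : ENNReal :=
  (cell N (proc x₀ χ ψ m ω) c).indicator 1
    (proc x₀ χ ψ m ω (χ m ω) + nearestDist (proc x₀ χ ψ m ω) (χ m ω) * ψ m ω)

theorem gapMass_le (x₀ : Fin n₀ → ℝ) (χ : ∀ m : ℕ, Ω → Fin (n₀ + m)) (ψ : ℕ → Ω → ℝ)
    (N c m : ℕ) (ω : Ω) : gapMass x₀ χ ψ N c m ω ≤ (n₀ + m : ℕ) :=
  hitMass_le _ _

theorem proc_injective (hn₀ : 2 ≤ n₀) (hx₀ : x₀.Injective) {ω : Ω}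
    (hω : ∀ m, |ψ m ω| < 1 ∧ ψ m ω ≠ 0) (m : ℕ) : (proc x₀ χ ψ m ω).Injective := by
  induction m with
  | zero => exact hx₀
  | succ m ih => exact addParticle_injective (by omega) ih _ (hω m).1 (hω m).2

theorem gapMass_succ (hn₀ : 2 ≤ n₀) (hx₀ : x₀.Injective) {ω : Ω}
    (hω : ∀ m, |ψ m ω| < 1 ∧ ψ m ω ≠ 0) {N m : ℕ} (hN : N ≤ n₀ + m) (c : ℕ) :
    gapMass x₀ χ ψ N c (m + 1) ω = gapMass x₀ χ ψ N c m ω + gapHit x₀ χ ψ N c m ω := by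
  unfold gapMass gapHit
  rw [proc_succ]
  conv_lhs => enter [2]; rw [cell_addParticle hN]
  exact hitMass_addParticle (by omega) (proc_injective hn₀ hx₀ hω m) (compatible_cell _ _ _) _
    (hω m).1 (hω m).2

end Pathwise

section RandomProc

variable {Ω : Type*} [MeasurableSpace Ω] {P : Measure Ω} {n₀ : ℕ}
  {χ : ∀ m : ℕ, Ω → Fin (n₀ + m)} {ψ : ℕ → Ω → ℝ}

theorem IsDriving.measurable_pair (h : IsDriving P n₀ χ ψ) (m : ℕ) :
    Measurable fun ω => (χ m ω, ψ m ω) :=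
  (h.measurable_parent m).prodMk (h.measurable_disp m)

theorem IsDriving.measurable_proc (h : IsDriving P n₀ χ ψ) (x₀ : Fin n₀ → ℝ) (m : ℕ) :
    Measurable (proc x₀ χ ψ m) :=
  (measurable_proc_iSup x₀ χ ψ m).mono
    (iSup₂_le fun i _ => (h.measurable_pair i).comap_le) le_rfl

theorem IsDriving.indepFun_proc (h : IsDriving P n₀ χ ψ) (x₀ : Fin n₀ → ℝ) (m : ℕ) :
    IndepFun (proc x₀ χ ψ m) (fun ω => (χ m ω, ψ m ω)) P := by
  have hI := indep_iSup_of_disjoint (fun i => (h.measurable_pair i).comap_le) h.iIndep.iIndep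
    (S := Set.Iio m) (T := {m}) (by simp)
  rw [IndepFun_iff_Indep]
  refine indep_of_indep_of_le_left (indep_of_indep_of_le_right hI ?_)
    (measurable_proc_iSup x₀ χ ψ m).comap_le
  exact le_biSup (fun i => MeasurableSpace.comap (fun ω => (χ i ω, ψ i ω)) inferInstance)
    (Set.mem_singleton m)

/-- Given the configuration after `m` steps, the next particle has law `nextMeasure`. -/
theorem IsDriving.lintegral_newParticle [IsProbabilityMeasure P] (h : IsDriving P n₀ χ ψ)
    (x₀ : Fin n₀ → ℝ) (m : ℕ) {F : (Fin (n₀ + m) → ℝ) → ℝ → ENNReal}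
    (hF : Measurable (Function.uncurry F)) :
    ∫⁻ ω, F (proc x₀ χ ψ m ω)
        (proc x₀ χ ψ m ω (χ m ω) + nearestDist (proc x₀ χ ψ m ω) (χ m ω) * ψ m ω) ∂P =
      ∫⁻ ω, ∫⁻ z, F (proc x₀ χ ψ m ω) z ∂nextMeasure (proc x₀ χ ψ m ω) ∂P := by
  have hX := h.measurable_proc x₀ m
  have hY := h.measurable_pair m
  set G : (Fin (n₀ + m) → ℝ) × Fin (n₀ + m) × ℝ → ENNReal :=
    fun p => F p.1 (p.1 p.2.1 + nearestDist p.1 p.2.1 * p.2.2) with hG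
  have hGm : Measurable G := hF.comp (measurable_fst.prodMk measurable_newParticle)
  have hmapY : P.map (fun ω => (χ m ω, ψ m ω)) = (P.map (χ m)).prod unifLaw := by
    rw [(indepFun_iff_map_prod_eq_prod_map_map (h.measurable_parent m).aemeasurable
      (h.measurable_disp m).aemeasurable).1 (h.indep m), h.map_disp]
  have hmap := (indepFun_iff_map_prod_eq_prod_map_map hX.aemeasurable hY.aemeasurable).1
    (h.indepFun_proc x₀ m)
  have hprobχ : IsProbabilityMeasure (P.map (χ m)) :=
    Measure.isProbabilityMeasure_map (h.measurable_parent m).aemeasurable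
  calc _ = ∫⁻ ω, G (proc x₀ χ ψ m ω, (χ m ω, ψ m ω)) ∂P := rfl
    _ = ∫⁻ p, G p ∂(P.map fun ω => (proc x₀ χ ψ m ω, (χ m ω, ψ m ω))) :=
        (lintegral_map hGm (hX.prodMk hY)).symm
    _ = ∫⁻ X, ∫⁻ y, G (X, y) ∂((P.map (χ m)).prod unifLaw) ∂(P.map (proc x₀ χ ψ m)) := by
        rw [hmap, hmapY, lintegral_prod _ hGm.aemeasurable]
    _ = ∫⁻ ω, ∫⁻ y, G (proc x₀ χ ψ m ω, y) ∂((P.map (χ m)).prod unifLaw) ∂P :=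
        lintegral_map hGm.lintegral_prod_right' hX
    _ = _ := by
        refine lintegral_congr fun ω => ?_
        rw [lintegral_nextMeasure _ hF.of_uncurry_left,
          lintegral_prod (fun y => G (proc x₀ χ ψ m ω, y)) (hGm.comp measurable_prodMk_left).aemeasurable,
          lintegral_fintype,
          Finset.mul_sum]
        refine Finset.sum_congr rfl fun k _ => ?_
        rw [Measure.map_apply (h.measurable_parent m) (measurableSet_singleton k), mul_comm]
        congr 1
        exact h.parent_eq m k

theorem IsDriving.measurable_gapMass (h : IsDriving P n₀ χ ψ) (x₀ : Fin n₀ → ℝ) (N c m : ℕ) :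
    Measurable (gapMass x₀ χ ψ N c m) :=
  (measurable_hitMass_cell N c).comp (h.measurable_proc x₀ m)

/-- The conditional probability of a hit in integrated form, with `φ` as a test function of the
present configuration. -/
theorem IsDriving.lintegral_mul_gapHit [IsProbabilityMeasure P] (h : IsDriving P n₀ χ ψ)
    (x₀ : Fin n₀ → ℝ) (N c m : ℕ) {φ : (Fin (n₀ + m) → ℝ) → ENNReal} (hφ : Measurable φ) :
    ∫⁻ ω, φ (proc x₀ χ ψ m ω) * gapHit x₀ χ ψ N c m ω ∂P =
      ∫⁻ ω, φ (proc x₀ χ ψ m ω) *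
        (((n₀ + m : ℕ) : ENNReal)⁻¹ * gapMass x₀ χ ψ N c m ω) ∂P := by
  have hind : Measurable (Function.uncurry fun (X : Fin (n₀ + m) → ℝ) (z : ℝ) =>
      φ X * (cell N X c).indicator (1 : ℝ → ENNReal) z) :=
    (hφ.comp measurable_fst).mul
      (measurable_one.indicator (measurableSet_mem_cell (n := n₀ + m) N c))
  refine (h.lintegral_newParticle x₀ m hind).trans (lintegral_congr fun ω => ?_)
  rw [lintegral_const_mul _ (measurable_one.indicator (measurableSet_cell _ _ _)),
    lintegral_indicator_one (measurableSet_cell _ _ _),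
    nextMeasure_apply _ (measurableSet_cell _ _ _), gapMass]

theorem IsDriving.ae_disp (h : IsDriving P n₀ χ ψ) :
    ∀ᵐ ω ∂P, ∀ m, |ψ m ω| < 1 ∧ ψ m ω ≠ 0 := by
  refine ae_all_iff.2 fun m => ?_
  have := ae_unifLaw
  rw [← h.map_disp m] at this
  exact ae_of_ae_map (h.measurable_disp m).aemeasurable this

end RandomProc

/-! ### Martingale convergence of the gap probabilities -/

theorem inv_succ_mul_add_inv {n : ℕ} (hn : n ≠ 0) (a : ENNReal) :
    ((n + 1 : ℕ) : ENNReal)⁻¹ * (a + (n : ENNReal)⁻¹ * a) = (n : ENNReal)⁻¹ * a := by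
  have h0 : (n : ENNReal) ≠ 0 := by exact_mod_cast hn
  have ht : (n : ENNReal) ≠ ⊤ := ENNReal.natCast_ne_top n
  have h1 : a + (n : ENNReal)⁻¹ * a = ((n + 1 : ℕ) : ENNReal) * ((n : ENNReal)⁻¹ * a) := by
    push_cast
    rw [add_mul, one_mul, ← mul_assoc, ENNReal.mul_inv_cancel h0 ht, one_mul]
  rw [h1, ← mul_assoc, ENNReal.inv_mul_cancel (by simp) (ENNReal.natCast_ne_top _), one_mul]

section Pathwise

variable {Ω : Type*} {n₀ : ℕ} {x₀ : Fin n₀ → ℝ}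
  {χ : ∀ m : ℕ, Ω → Fin (n₀ + m)} {ψ : ℕ → Ω → ℝ}

/-- The mass that `nextMeasure` gives to the gap number `c` between the first `N` particles. -/
noncomputable def gapProb (x₀ : Fin n₀ → ℝ)
    (χ : ∀ m : ℕ, Ω → Fin (n₀ + m)) (ψ : ℕ → Ω → ℝ) (N c m : ℕ) (ω : Ω) : ENNReal :=
  ((n₀ + m : ℕ) : ENNReal)⁻¹ * gapMass x₀ χ ψ N c m ω

theorem gapProb_le_one (hn₀ : 2 ≤ n₀) (N c m : ℕ) (ω : Ω) : gapProb x₀ χ ψ N c m ω ≤ 1 := by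
  refine (mul_le_mul_right (gapMass_le x₀ χ ψ N c m ω) _).trans_eq ?_
  exact ENNReal.inv_mul_cancel (by simp; omega) (ENNReal.natCast_ne_top _)

end Pathwise

section RandomProc

variable {Ω : Type*} [MeasurableSpace Ω] {P : Measure Ω} {n₀ : ℕ} {x₀ : Fin n₀ → ℝ}
  {χ : ∀ m : ℕ, Ω → Fin (n₀ + m)} {ψ : ℕ → Ω → ℝ}

theorem IsDriving.measurable_gapProb (h : IsDriving P n₀ χ ψ) (x₀ : Fin n₀ → ℝ) (N c m : ℕ) :
    Measurable (gapProb x₀ χ ψ N c m) :=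
  (h.measurable_gapMass x₀ N c m).const_mul _

/-- The gap probabilities form a martingale. -/
theorem IsDriving.lintegral_mul_gapProb_succ [IsProbabilityMeasure P] (h : IsDriving P n₀ χ ψ)
    (hn₀ : 2 ≤ n₀) (hx₀ : x₀.Injective) {N m : ℕ} (hN : N ≤ n₀ + m) (c : ℕ)
    {φ : (Fin (n₀ + m) → ℝ) → ENNReal} (hφ : Measurable φ) :
    ∫⁻ ω, φ (proc x₀ χ ψ m ω) * gapProb x₀ χ ψ N c (m + 1) ω ∂P =
      ∫⁻ ω, φ (proc x₀ χ ψ m ω) * gapProb x₀ χ ψ N c m ω ∂P := by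
  have hφM : Measurable fun ω => φ (proc x₀ χ ψ m ω) * gapMass x₀ χ ψ N c m ω :=
    (hφ.comp (h.measurable_proc x₀ m)).mul (h.measurable_gapMass x₀ N c m)
  calc _ = ∫⁻ ω, ((n₀ + m + 1 : ℕ) : ENNReal)⁻¹ *
          (φ (proc x₀ χ ψ m ω) * gapMass x₀ χ ψ N c m ω +
            φ (proc x₀ χ ψ m ω) * gapHit x₀ χ ψ N c m ω) ∂P := by
        refine lintegral_congr_ae ?_
        filter_upwards [h.ae_disp] with ω hω
        rw [gapProb, gapMass_succ hn₀ hx₀ hω hN, ← mul_add, mul_left_comm]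
        rfl
    _ = ((n₀ + m + 1 : ℕ) : ENNReal)⁻¹ *
          (∫⁻ ω, φ (proc x₀ χ ψ m ω) * gapMass x₀ χ ψ N c m ω ∂P +
            ∫⁻ ω, φ (proc x₀ χ ψ m ω) *
              (((n₀ + m : ℕ) : ENNReal)⁻¹ * gapMass x₀ χ ψ N c m ω) ∂P) := by
        rw [lintegral_const_mul' _ _ (by simp), lintegral_add_left hφM,
          h.lintegral_mul_gapHit x₀ N c m hφ]
    _ = ((n₀ + m : ℕ) : ENNReal)⁻¹ * ∫⁻ ω, φ (proc x₀ χ ψ m ω) * gapMass x₀ χ ψ N c m ω ∂P := by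
        simp only [mul_left_comm _ (((n₀ + m : ℕ) : ENNReal)⁻¹)]
        rw [lintegral_const_mul' _ _ (by simp; omega), inv_succ_mul_add_inv (by omega)]
    _ = _ := by
        rw [← lintegral_const_mul' _ _ (by simp; omega)]
        simp only [gapProb, mul_left_comm _ (((n₀ + m : ℕ) : ENNReal)⁻¹)]

/-- The filtration generated by the configurations from step `M` on. -/
noncomputable def IsDriving.filtration (h : IsDriving P n₀ χ ψ) (x₀ : Fin n₀ → ℝ) (M : ℕ) :
    Filtration ℕ ‹MeasurableSpace Ω› where
  seq i := MeasurableSpace.comap (proc x₀ χ ψ (M + i)) inferInstance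
  mono' := by
    refine monotone_nat_of_le_succ fun i => ?_
    -- Each configuration is a restriction of the next, so the σ-algebras of single configurations
    -- already increase.
    have hX : proc x₀ χ ψ (M + i) =
        (fun (X : Fin (n₀ + (M + i) + 1) → ℝ) j => X j.castSucc) ∘ proc x₀ χ ψ (M + (i + 1)) := by
      ext ω j
      exact (Fin.snoc_castSucc (α := fun _ => ℝ) _ _ _).symm
    rw [hX, ← MeasurableSpace.comap_comp]
    exact MeasurableSpace.comap_mono
      (measurable_pi_lambda _ fun j => measurable_pi_apply j.castSucc).comap_le
  le' i := (h.measurable_proc x₀ (M + i)).comap_le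

theorem IsDriving.martingale_gapProb [IsProbabilityMeasure P] (h : IsDriving P n₀ χ ψ)
    (hn₀ : 2 ≤ n₀) (hx₀ : x₀.Injective) (M c : ℕ) :
    Martingale (fun i ω => (gapProb x₀ χ ψ (n₀ + M) c (M + i) ω).toReal)
      (h.filtration x₀ M) P := by
  have hlt (i : ℕ) (ω : Ω) : gapProb x₀ χ ψ (n₀ + M) c i ω < ⊤ :=
    (gapProb_le_one hn₀ _ _ _ _).trans_lt ENNReal.one_lt_top
  refine martingale_of_setIntegral_eq_succ (fun i => ?_) (fun i => ?_) fun i s hs => ?_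
  · have hm : Measurable fun X : Fin (n₀ + (M + i)) → ℝ =>
        (((n₀ + (M + i) : ℕ) : ENNReal)⁻¹ * hitMass X (cell (n₀ + M) X c)).toReal :=
      ((measurable_hitMass_cell _ _).const_mul _).ennreal_toReal
    exact (hm.comp (comap_measurable (proc x₀ χ ψ (M + i)))).stronglyMeasurable
  · exact Integrable.of_bound
      (h.measurable_gapProb x₀ _ _ _).ennreal_toReal.aestronglyMeasurable 1
      (Eventually.of_forall fun ω => by
        rw [Real.norm_of_nonneg ENNReal.toReal_nonneg]
        exact ENNReal.toReal_mono ENNReal.one_ne_top (gapProb_le_one hn₀ _ _ _ _))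
  · obtain ⟨B, hB, rfl⟩ := hs
    have hS : MeasurableSet (proc x₀ χ ψ (M + i) ⁻¹' B) := h.measurable_proc x₀ (M + i) hB
    rw [integral_toReal (h.measurable_gapProb x₀ _ _ _).aemeasurable
        (Eventually.of_forall fun ω => hlt _ ω),
      integral_toReal (h.measurable_gapProb x₀ _ _ _).aemeasurable
        (Eventually.of_forall fun ω => hlt _ ω)]
    congr 1
    have key := h.lintegral_mul_gapProb_succ hn₀ hx₀ (N := n₀ + M) (m := M + i) (by omega) c
      (φ := B.indicator 1) (measurable_one.indicator hB)
    have hind (f : Ω → ENNReal) : (fun ω => B.indicator 1 (proc x₀ χ ψ (M + i) ω) * f ω) =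
        (proc x₀ χ ψ (M + i) ⁻¹' B).indicator f := by
      ext ω
      by_cases hω : proc x₀ χ ψ (M + i) ω ∈ B
      · simp [hω]
      · simp [hω]
    rw [hind, hind, lintegral_indicator hS, lintegral_indicator hS] at key
    exact key.symm

theorem IsDriving.ae_tendsto_gapProb [IsProbabilityMeasure P] (h : IsDriving P n₀ χ ψ)
    (hn₀ : 2 ≤ n₀) (hx₀ : x₀.Injective) :
    ∀ᵐ ω ∂P, ∀ M c, ∃ p,
      Tendsto (fun m => (gapProb x₀ χ ψ (n₀ + M) c m ω).toReal) atTop (𝓝 p) := by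
  refine ae_all_iff.2 fun M => ae_all_iff.2 fun c => ?_
  have hbdd (i : ℕ) : eLpNorm (fun ω => (gapProb x₀ χ ψ (n₀ + M) c (M + i) ω).toReal) 1 P ≤
      (1 : NNReal) := by
    refine (eLpNorm_le_of_ae_bound (C := 1) (Eventually.of_forall fun ω => ?_)).trans (by simp)
    rw [Real.norm_of_nonneg ENNReal.toReal_nonneg]
    exact ENNReal.toReal_mono ENNReal.one_ne_top (gapProb_le_one hn₀ _ _ _ _)
  filter_upwards [(h.martingale_gapProb hn₀ hx₀ M c).submartingale.exists_ae_tendsto_of_bdd hbdd]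
    with ω ⟨p, hp⟩
  refine ⟨p, (tendsto_add_atTop_iff_nat M).1 ?_⟩
  simpa only [add_comm] using hp

/-! ### Second moments and small gaps -/

/-- The rising second moment of the gap masses satisfies the recursion of a Polya urn. -/
theorem IsDriving.lintegral_gapMass_succ [IsProbabilityMeasure P] (h : IsDriving P n₀ χ ψ)
    (hn₀ : 2 ≤ n₀) (hx₀ : x₀.Injective) {N m : ℕ} (hN : N ≤ n₀ + m) (c : ℕ) :
    ∫⁻ ω, gapMass x₀ χ ψ N c (m + 1) ω * (gapMass x₀ χ ψ N c (m + 1) ω + 1) ∂P =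
      (1 + 2 * ((n₀ + m : ℕ) : ENNReal)⁻¹) *
        ∫⁻ ω, gapMass x₀ χ ψ N c m ω * (gapMass x₀ χ ψ N c m ω + 1) ∂P := by
  have hM := h.measurable_gapMass x₀ N c m
  have hV : Measurable fun ω => gapMass x₀ χ ψ N c m ω * (gapMass x₀ χ ψ N c m ω + 1) :=
    hM.mul (hM.add_const 1)
  have hφ : Measurable fun X : Fin (n₀ + m) → ℝ => 2 * (hitMass X (cell N X c) + 1) :=
    ((measurable_hitMass_cell N c).add_const 1).const_mul 2
  calc _ = ∫⁻ ω, gapMass x₀ χ ψ N c m ω * (gapMass x₀ χ ψ N c m ω + 1) +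
          2 * (gapMass x₀ χ ψ N c m ω + 1) * gapHit x₀ χ ψ N c m ω ∂P := by
        refine lintegral_congr_ae ?_
        filter_upwards [h.ae_disp] with ω hω
        rw [gapMass_succ hn₀ hx₀ hω hN]
        -- For an increment `0` or `1`, `V (V + 1)` grows by `2 (V + 1)` times the increment.
        have h01 : gapHit x₀ χ ψ N c m ω = 0 ∨ gapHit x₀ χ ψ N c m ω = 1 := by
          unfold gapHit
          exact Set.indicator_eq_zero_or_self _ _ _
        rcases h01 with h' | h' <;> rw [h'] <;> ring
    _ = ∫⁻ ω, gapMass x₀ χ ψ N c m ω * (gapMass x₀ χ ψ N c m ω + 1) ∂P +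
          ∫⁻ ω, 2 * ((n₀ + m : ℕ) : ENNReal)⁻¹ *
            (gapMass x₀ χ ψ N c m ω * (gapMass x₀ χ ψ N c m ω + 1)) ∂P := by
        rw [lintegral_add_left hV]
        congr 1
        refine (h.lintegral_mul_gapHit x₀ N c m hφ).trans (lintegral_congr fun ω => ?_)
        simp only [gapMass]
        ring
    _ = _ := by
        rw [lintegral_const_mul _ hV]
        ring

/-- The urn factor `1 + 2 / n = (n + 2) / n` carries `n (n + 1)` to `(n + 1) (n + 2)`. The `3` comes
from `V + 1 ≤ 3` at the start, where the `V` sum to at most `n₀ + M`. -/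
theorem IsDriving.sum_lintegral_gapMass_le [IsProbabilityMeasure P] (h : IsDriving P n₀ χ ψ)
    (hn₀ : 2 ≤ n₀) (hx₀ : x₀.Injective) (M i : ℕ) (s : Finset ℕ) :
    ((n₀ + M + 1 : ℕ) : ENNReal) * ∑ c ∈ s, ∫⁻ ω, gapMass x₀ χ ψ (n₀ + M) c (M + i) ω *
        (gapMass x₀ χ ψ (n₀ + M) c (M + i) ω + 1) ∂P ≤
      3 * ((n₀ + (M + i) : ℕ) : ENNReal) * ((n₀ + (M + i) + 1 : ℕ) : ENNReal) := by
  induction i with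
  | zero =>
    have hM (c : ℕ) := h.measurable_gapMass x₀ (n₀ + M) c M
    rw [add_zero, mul_comm]
    refine mul_le_mul_left ?_ _
    calc _ ≤ ∑ c ∈ s, ∫⁻ ω, gapMass x₀ χ ψ (n₀ + M) c M ω * 3 ∂P := by
          refine Finset.sum_le_sum fun c _ => lintegral_mono_ae ?_
          filter_upwards [h.ae_disp] with ω hω
          refine mul_le_mul_right ?_ _
          refine (add_le_add_left (hitMass_cell_le (proc_injective hn₀ hx₀ hω M) c) 1).trans_eq ?_
          norm_num
      _ = ∫⁻ ω, (∑ c ∈ s, gapMass x₀ χ ψ (n₀ + M) c M ω) * 3 ∂P := by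
          rw [← lintegral_finsetSum _ fun c _ => (hM c).mul_const 3]
          simp only [Finset.sum_mul]
      _ ≤ ∫⁻ _ω, 3 * ((n₀ + M : ℕ) : ENNReal) ∂P := by
          refine lintegral_mono fun ω => ?_
          rw [mul_comm]
          exact mul_le_mul_right (sum_hitMass_cell_le _ _ s) _
      _ = _ := by simp
  | succ i ih =>
    have h0 : ((n₀ + (M + i) : ℕ) : ENNReal) ≠ 0 := by simp; omega
    rw [← add_assoc]
    simp only [h.lintegral_gapMass_succ hn₀ hx₀ (N := n₀ + M) (m := M + i) (by omega)]
    rw [← Finset.mul_sum, mul_left_comm]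
    refine (mul_le_mul_right ih _).trans_eq ?_
    rw [show n₀ + (M + i + 1) = n₀ + (M + i) + 1 from rfl]
    generalize n₀ + (M + i) = n at *
    have hc : (1 + 2 * (n : ENNReal)⁻¹) * n = n + 2 := by
      rw [add_mul, one_mul, mul_assoc, ENNReal.inv_mul_cancel h0 (ENNReal.natCast_ne_top _),
        mul_one]
    rw [show (1 + 2 * (n : ENNReal)⁻¹) * (3 * n * ((n + 1 : ℕ) : ENNReal)) =
      3 * ((n + 1 : ℕ) : ENNReal) * ((1 + 2 * (n : ENNReal)⁻¹) * n) by ring, hc]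
    push_cast
    ring

theorem IsDriving.lintegral_sum_gapProb_sq_le [IsProbabilityMeasure P] (h : IsDriving P n₀ χ ψ)
    (hn₀ : 2 ≤ n₀) (hx₀ : x₀.Injective) (M i : ℕ) (s : Finset ℕ) :
    ∫⁻ ω, ∑ c ∈ s, gapProb x₀ χ ψ (n₀ + M) c (M + i) ω ^ 2 ∂P ≤
      6 * ((n₀ + M + 1 : ℕ) : ENNReal)⁻¹ := by
  have hsum := h.sum_lintegral_gapMass_le hn₀ hx₀ M i s
  have hV (c : ℕ) : Measurable fun ω => gapMass x₀ χ ψ (n₀ + M) c (M + i) ω *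
      (gapMass x₀ χ ψ (n₀ + M) c (M + i) ω + 1) :=
    (h.measurable_gapMass x₀ _ _ _).mul ((h.measurable_gapMass x₀ _ _ _).add_const 1)
  have hn0 : ((n₀ + (M + i) : ℕ) : ENNReal) ≠ 0 := by simp; omega
  have hn1 : 1 ≤ n₀ + (M + i) := by omega
  simp only [gapProb]
  generalize n₀ + (M + i) = n at *
  have hcancel : (n : ENNReal)⁻¹ * n = 1 := ENNReal.inv_mul_cancel hn0 (ENNReal.natCast_ne_top n)
  calc _ ≤ ∫⁻ ω, (n : ENNReal)⁻¹ ^ 2 * ∑ c ∈ s, gapMass x₀ χ ψ (n₀ + M) c (M + i) ω *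
          (gapMass x₀ χ ψ (n₀ + M) c (M + i) ω + 1) ∂P := by
        refine lintegral_mono fun ω => ?_
        rw [Finset.mul_sum]
        refine Finset.sum_le_sum fun c _ => ?_
        rw [mul_pow, pow_two (gapMass _ _ _ _ _ _ _)]
        gcongr
        exact le_self_add
    _ = (n : ENNReal)⁻¹ ^ 2 * ∑ c ∈ s, ∫⁻ ω, gapMass x₀ χ ψ (n₀ + M) c (M + i) ω *
          (gapMass x₀ χ ψ (n₀ + M) c (M + i) ω + 1) ∂P := by
        rw [lintegral_const_mul' _ _ (by simp; omega),
          lintegral_finsetSum _ fun c _ => hV c]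
    -- The bound `n + 1 ≤ 2 * n` turns the constant `3` into `6`.
    _ ≤ (n : ENNReal)⁻¹ ^ 2 * (((n₀ + M + 1 : ℕ) : ENNReal)⁻¹ * (3 * n * (2 * n))) := by
        gcongr
        rw [mul_comm, ← div_eq_mul_inv, ENNReal.le_div_iff_mul_le (by simp) (by simp), mul_comm]
        refine hsum.trans ?_
        gcongr
        exact_mod_cast (by omega : n + 1 ≤ 2 * n)
    _ = ((n : ENNReal)⁻¹ * n) ^ 2 * (6 * ((n₀ + M + 1 : ℕ) : ENNReal)⁻¹) := by ring
    _ = _ := by rw [hcancel, one_pow, one_mul]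

/-- By Fatou the lower limit of the sum of squares has expectation at most `6 / (n₀ + M + 1)`, so
its infimum over `M` vanishes almost surely. A lower limit yields smallness only frequently. -/
theorem IsDriving.ae_frequently_gapProb_le [IsProbabilityMeasure P] (h : IsDriving P n₀ χ ψ)
    (hn₀ : 2 ≤ n₀) (hx₀ : x₀.Injective) :
    ∀ᵐ ω ∂P, ∀ ε : ENNReal, 0 < ε → ∃ M, ∃ᶠ m in atTop, ∀ c < n₀ + M + 1,
      gapProb x₀ χ ψ (n₀ + M) c m ω ≤ ε := by
  set R : ℕ → Ω → ENNReal := fun M ω => liminf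
    (fun i => ∑ c ∈ Finset.range (n₀ + M + 1), gapProb x₀ χ ψ (n₀ + M) c (M + i) ω ^ 2) atTop
    with hR
  have hm (M i : ℕ) : Measurable fun ω =>
      ∑ c ∈ Finset.range (n₀ + M + 1), gapProb x₀ χ ψ (n₀ + M) c (M + i) ω ^ 2 :=
    Finset.measurable_sum _ fun c _ => (h.measurable_gapProb x₀ _ _ _).pow_const 2
  have hRm (M : ℕ) : Measurable (R M) := Measurable.liminf (hm M)
  have hint (M : ℕ) : ∫⁻ ω, R M ω ∂P ≤ 6 * ((n₀ + M + 1 : ℕ) : ENNReal)⁻¹ := by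
    refine (lintegral_liminf_le (hm M)).trans ?_
    refine liminf_le_of_le (by isBoundedDefault) fun b hb => ?_
    obtain ⟨i, hi⟩ := hb.exists
    exact hi.trans (h.lintegral_sum_gapProb_sq_le hn₀ hx₀ M i _)
  have hzero : ∫⁻ ω, ⨅ M, R M ω ∂P = 0 := by
    have hlim : Tendsto (fun M : ℕ => 6 * ((n₀ + M + 1 : ℕ) : ENNReal)⁻¹) atTop (𝓝 0) := by
      have h1 : Tendsto (fun M : ℕ => ((n₀ + M + 1 : ℕ) : ENNReal)⁻¹) atTop (𝓝 0) :=
        ENNReal.tendsto_inv_nat_nhds_zero.comp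
          (tendsto_atTop_mono (fun M => (by omega : M ≤ n₀ + M + 1)) tendsto_id)
      simpa using ENNReal.Tendsto.const_mul h1 (Or.inr (by norm_num : (6 : ENNReal) ≠ ⊤))
    refine le_antisymm (ge_of_tendsto' hlim fun M => ?_) zero_le
    exact (lintegral_mono fun ω => iInf_le _ M).trans (hint M)
  rw [lintegral_eq_zero_iff (Measurable.iInf hRm)] at hzero
  filter_upwards [hzero] with ω hω ε hε
  have hlt : ⨅ M, R M ω < ε ^ 2 := by
    rw [hω]
    exact ENNReal.pow_pos hε 2
  obtain ⟨M, hM⟩ := iInf_lt_iff.1 hlt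
  refine ⟨M, ?_⟩
  have hfr := frequently_lt_of_liminf_lt (by isBoundedDefault) hM
  have htend : Tendsto (fun i => M + i) atTop atTop :=
    tendsto_atTop_mono (fun i => Nat.le_add_left i M) tendsto_id
  refine htend.frequently (hfr.mono fun i hi c hc => ?_)
  have h2 : gapProb x₀ χ ψ (n₀ + M) c (M + i) ω ^ 2 ≤ ε ^ 2 :=
    (Finset.single_le_sum (f := fun c => gapProb x₀ χ ψ (n₀ + M) c (M + i) ω ^ 2)
      (fun _ _ => zero_le) (Finset.mem_range.2 hc)).trans hi.le
  exact (ENNReal.pow_le_pow_left_iff two_ne_zero).1 h2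

end RandomProc

/-! ### Almost sure convergence and a measurable limit -/

theorem rankBelow_proc {Ω : Type*} {n₀ : ℕ} (x₀ : Fin n₀ → ℝ) (χ : ∀ m : ℕ, Ω → Fin (n₀ + m))
    (ψ : ℕ → Ω → ℝ) (M i : ℕ) (ω : Ω) :
    rankBelow (n₀ + M) (proc x₀ χ ψ (M + i) ω) = rankBelow (n₀ + M) (proc x₀ χ ψ M ω) := by
  induction i with
  | zero => rfl
  | succ i ih => exact (rankBelow_addParticle (Nat.add_le_add_left (Nat.le_add_right M i) n₀) _ _ _).trans ih

theorem IsDriving.ae_exists_tendsto {Ω : Type*} [MeasurableSpace Ω] {P : Measure Ω}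
    [IsProbabilityMeasure P] {n₀ : ℕ} {x₀ : Fin n₀ → ℝ} {χ : ∀ m : ℕ, Ω → Fin (n₀ + m)}
    {ψ : ℕ → Ω → ℝ} (h : IsDriving P n₀ χ ψ) (hn₀ : 2 ≤ n₀) (hx₀ : x₀.Injective) :
    ∀ᵐ ω ∂P, ∃ ν : ProbabilityMeasure ℝ,
      Tendsto (fun m => nextLaw (Nat.le_add_right_of_le hn₀ : 2 ≤ n₀ + m) (proc x₀ χ ψ m ω))
        atTop (𝓝 ν) ∧ Continuous (cdf (ν : Measure ℝ)) := by
  filter_upwards [h.ae_disp, h.ae_tendsto_gapProb hn₀ hx₀, h.ae_frequently_gapProb_le hn₀ hx₀]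
    with ω hω hlim hfr
  have hgap {M m : ℕ} (hm : M ≤ m) (c : ℕ) :
      (nextLaw (Nat.le_add_right_of_le hn₀ : 2 ≤ n₀ + m) (proc x₀ χ ψ m ω) : Measure ℝ).real
        (rankBelow (n₀ + M) (proc x₀ χ ψ M ω) ⁻¹' {c}) =
      (gapProb x₀ χ ψ (n₀ + M) c m ω).toReal := by
    obtain ⟨i, rfl⟩ := Nat.exists_eq_add_of_le hm
    rw [← rankBelow_proc x₀ χ ψ M i ω]
    exact congrArg ENNReal.toReal (nextMeasure_apply _ (measurableSet_cell _ _ c))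
  refine exists_tendsto_of_levels (fun m => ?_) fun ε hε => ?_
  · exact continuous_cdf_of_measure_singleton _
      (nextMeasure_singleton (by omega) (proc_injective hn₀ hx₀ hω m))
  · obtain ⟨M, hM⟩ := hfr (ENNReal.ofReal ε) (ENNReal.ofReal_pos.2 hε)
    refine ⟨rankBelow (n₀ + M) (proc x₀ χ ψ M ω), n₀ + M + 1, rankBelow_mono _ _,
      rankBelow_lt _ _, fun c => ?_, ?_⟩
    · obtain ⟨p, hp⟩ := hlim M c
      refine ⟨p, hp.congr' ?_⟩
      filter_upwards [eventually_ge_atTop M] with m hm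
      exact (hgap hm c).symm
    · refine (hM.and_eventually (eventually_ge_atTop M)).mono fun m hm c hc => ?_
      rw [hgap hm.2 c]
      exact ENNReal.toReal_le_of_le_ofReal hε.le (hm.1 c hc)

theorem tendsto_measure_Iic_of_tendsto {μ : ℕ → ProbabilityMeasure ℝ} {ν : ProbabilityMeasure ℝ}
    (h : Tendsto μ atTop (𝓝 ν)) (hν : Continuous (cdf (ν : Measure ℝ))) (t : ℝ) :
    Tendsto (fun m => (μ m : Measure ℝ) (Set.Iic t)) atTop (𝓝 ((ν : Measure ℝ) (Set.Iic t))) := by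
  refine ProbabilityMeasure.tendsto_measure_of_null_frontier_of_tendsto' h ?_
  have hc := (monotone_cdf (ν : Measure ℝ)).continuousAt_iff_leftLim_eq_rightLim.1
    (hν.continuousAt (x := t))
  rw [(cdf (ν : Measure ℝ)).rightLim_eq] at hc
  rw [frontier_Iic, ← measure_cdf (ν : Measure ℝ), StieltjesFunction.measure_singleton, hc,
    sub_self, ENNReal.ofReal_zero]

theorem IsDriving.exists_measurable_limit {Ω : Type*} [MeasurableSpace Ω] {P : Measure Ω}
    [IsProbabilityMeasure P] {n₀ : ℕ} {x₀ : Fin n₀ → ℝ} {χ : ∀ m : ℕ, Ω → Fin (n₀ + m)}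
    {ψ : ℕ → Ω → ℝ} (h : IsDriving P n₀ χ ψ) (hn₀ : 2 ≤ n₀) (hx₀ : x₀.Injective) :
    ∃ μlim : Ω → ProbabilityMeasure ℝ, Measurable (fun ω => (μlim ω : Measure ℝ)) ∧
      ∀ᵐ ω ∂P,
        Tendsto (fun m => nextLaw (Nat.le_add_right_of_le hn₀ : 2 ≤ n₀ + m) (proc x₀ χ ψ m ω))
          atTop (𝓝 (μlim ω)) ∧ Continuous (cdf (μlim ω : Measure ℝ)) := by
  classical
  obtain ⟨E, hE, hEm, hEsub⟩ :=
    IsMeasurablyGenerated.exists_measurable_subset (h.ae_exists_tendsto hn₀ hx₀)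
  choose! ν hν hνc using fun ω (hω : ω ∈ E) => hEsub hω
  -- The chosen limits are used on a measurable set of full measure and a Dirac mass elsewhere.
  -- Measurability is tested on half-lines, where the values are pointwise limits of measurable
  -- functions.
  refine ⟨fun ω => if ω ∈ E then ν ω else ⟨Measure.dirac 0, inferInstance⟩, ?_, ?_⟩
  · refine Measurable.measure_of_isPiSystem_of_isProbabilityMeasure
      (borel_eq_generateFrom_Iic ℝ ▸ BorelSpace.measurable_eq) isPiSystem_Iic ?_
    rintro _ ⟨t, rfl⟩
    refine ENNReal.measurable_of_tendsto (f := fun m ω => if ω ∈ E then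
      nextMeasure (proc x₀ χ ψ m ω) (Set.Iic t) else Measure.dirac (0 : ℝ) (Set.Iic t))
      (fun m => Measurable.ite hEm ((measurable_nextMeasure_Iic t).comp (h.measurable_proc x₀ m))
        measurable_const) (tendsto_pi_nhds.2 fun ω => ?_)
    by_cases hω : ω ∈ E
    · simp only [hω, if_true]
      exact tendsto_measure_Iic_of_tendsto (hν ω hω) (hνc ω hω) t
    · simp only [hω, if_false]
      exact tendsto_const_nhds
  · filter_upwards [hE] with ω hω
    simp only [hω]
    exact ⟨hν ω hω, hνc ω hω⟩

end Lisa

theorem mainTheorem3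
    {Ω : Type*} [MeasurableSpace Ω] (P : Measure Ω) [IsProbabilityMeasure P]
    (n₀ : ℕ) (hn₀ : 2 ≤ n₀) (x₀ : Fin n₀ → ℝ) (hx₀ : Function.Injective x₀)
    (χ : ∀ m : ℕ, Ω → Fin (n₀ + m)) (ψ : ℕ → Ω → ℝ)
    (hχm : ∀ m, Measurable (χ m)) (hψm : ∀ m, Measurable (ψ m))
    (hχ : ∀ (m : ℕ) (k : Fin (n₀ + m)), P {ω | χ m ω = k} = ((n₀ + m : ℕ) : ENNReal)⁻¹)
    (hψ : ∀ m, P.map (ψ m) = Lisa.unifLaw)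
    (hindep : iIndepFun (fun m ω => (χ m ω, ψ m ω)) P)
    (hindep' : ∀ m, IndepFun (χ m) (ψ m) P) :
    ∃ μlim : Ω → ProbabilityMeasure ℝ,
      Measurable (fun ω => (μlim ω : Measure ℝ)) ∧
      ∀ᵐ ω ∂P,
        Tendsto
          (fun m => Lisa.nextLaw (Nat.le_add_right_of_le hn₀ : 2 ≤ n₀ + m)
            (Lisa.config x₀ (fun i => χ i ω) (fun i => ψ i ω) m))
          atTop (𝓝 (μlim ω)) ∧
        Continuous (cdf (μlim ω : Measure ℝ)) :=
  Lisa.IsDriving.exists_measurable_limit ⟨hχm, hψm, hχ, hψ, hindep, hindep'⟩ hn₀ hx₀
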